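/- Consider the simply typed $\lambda$-calculus (typed à la Church) with one ground type $\circ$ and a finite set of constants, all of type $\circ$. A term is $\eta$-long if each of its subterms that is not in function position of an application is of type $\circ$ or an abstraction. Closed terms $t,t'$ of the same type are observationally equivalent, $t\equiv t'$, if: at type $\circ$, $t=_\beta t'$; at type $A\to B$, $(t\,u)\equiv(t'\,u)$ for every closed $u:A$. A cell with free variable $y : B_1\to\dots\to B_p\to\circ$ is a context $\Sigma[\ ]_1\dots[\ ]_K = y\,(C_1[\ ]_1\dots[\ ]_K)\dots(C_p[\ ]_1\dots[\ ]_K)$, where the holes are of type $\circ$ and each $C_i$ is an $\eta$-long context of type $B_i$ with no free variables (holes may be unused or repeated, and are filled without capture of variables). Cellular terms are defined inductively: a closed term is cellular if it has the form $\lambda y_1\dots y_n.\,a$ with $a$ a constant, or the form $\lambda y_1\dots y_n.\,\Sigma[w_1]\dots[w_K]$, where $\Sigma$ is a cell whose free variable is among $y_1,\dots,y_n$ and each $\lambda y_1\dots y_n.\,w_j$ is a cellular term with $w_j$ of type $\circ$. Then for every type $A$ there is a closed term $t : A\to A$ which is cellular, is observationally equivalent to the $\eta$-long form of the identity $\lambda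 x.\,x$ of type $A\to A$, and is such that for every closed term $w : A$ the $\beta$-normal form of $(t\,w)$ is a cellular term observationally equivalent to $w$. -/

import Mathlib

namespace STLC

/-- Simple types over a single ground type `o`. -/
inductive Ty : Type
  | o : Ty
  | arr : Ty → Ty → Ty

/-- Typing contexts. -/
abbrev Ctx : Type := List Ty

/-- Typed de Bruijn indices. -/
inductive Var : Ctx → Ty → Type
  | vz {Γ : Ctx} {A : Ty} : Var (A :: Γ) A
  | vs {Γ : Ctx} {A B : Ty} : Var Γ A → Var (B :: Γ) A

/-- Simply typed lambda-terms (typing a la Church) of type `A` in the context `Γ`, over a set `C` of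
constants, all of ground type. Terms are identified up to renaming of bound variables. -/
inductive Tm (C : Type*) : Ctx → Ty → Type _
  | var {Γ : Ctx} {A : Ty} : Var Γ A → Tm C Γ A
  | const {Γ : Ctx} : C → Tm C Γ Ty.o
  | app {Γ : Ctx} {A B : Ty} : Tm C Γ (Ty.arr A B) → Tm C Γ A → Tm C Γ B
  | lam {Γ : Ctx} {A B : Ty} : Tm C (A :: Γ) B → Tm C Γ (Ty.arr A B)

/-- Closed terms of type `A`. -/
abbrev Closed (C : Type*) (A : Ty) : Type _ := Tm C [] A

/-! ### Renaming and capture-avoiding substitution -/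

/-- Renamings of variables. -/
abbrev Ren (Γ Δ : Ctx) : Type := ∀ A : Ty, Var Γ A → Var Δ A

/-- Pushing a renaming under a binder. -/
def Ren.lift {Γ Δ : Ctx} (ρ : Ren Γ Δ) (B : Ty) : Ren (B :: Γ) (B :: Δ)
  | _, Var.vz => Var.vz
  | _, Var.vs x => Var.vs (ρ _ x)

/-- Action of a renaming on a term. -/
def Tm.rename {C : Type*} : {Γ Δ : Ctx} → {A : Ty} → Ren Γ Δ → Tm C Γ A → Tm C Δ A
  | _, _, _, ρ, .var x => .var (ρ _ x)
  | _, _, _, _, .const a => .const a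
  | _, _, _, ρ, .app f a => .app (f.rename ρ) (a.rename ρ)
  | _, _, _, ρ, .lam b => .lam (b.rename (ρ.lift _))

/-- Weakening. -/
def Tm.weaken {C : Type*} {Γ : Ctx} {A : Ty} (B : Ty) (t : Tm C Γ A) : Tm C (B :: Γ) A :=
  t.rename (fun _ x => Var.vs x)

/-- Simultaneous substitutions: a term over `Δ` for each variable of `Γ`. -/
abbrev Subst (C : Type*) (Γ Δ : Ctx) : Type _ := ∀ A : Ty, Var Γ A → Tm C Δ A

/-- Pushing a substitution under a binder. -/
def Subst.lift {C : Type*} {Γ Δ : Ctx} (σ : Subst C Γ Δ) (B : Ty) : Subst C (B :: Γ) (B :: Δ)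
  | _, Var.vz => Tm.var Var.vz
  | _, Var.vs x => (σ _ x).weaken B

/-- Action of a simultaneous substitution on a term. -/
def Tm.subst {C : Type*} : {Γ Δ : Ctx} → {A : Ty} → Subst C Γ Δ → Tm C Γ A → Tm C Δ A
  | _, _, _, σ, .var x => σ _ x
  | _, _, _, _, .const a => .const a
  | _, _, _, σ, .app f a => .app (f.subst σ) (a.subst σ)
  | _, _, _, σ, .lam b => .lam (b.subst (σ.lift _))

/-- The substitution of `u` for the last variable of the context. -/
def Subst.single {C : Type*} {Γ : Ctx} {B : Ty} (u : Tm C Γ B) : Subst C (B :: Γ) Γ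
  | _, Var.vz => u
  | _, Var.vs x => Tm.var x

/-- `b[u/x]`, where `x` is the last variable of the context of `b`. -/
def Tm.inst {C : Type*} {Γ : Ctx} {A B : Ty} (b : Tm C (B :: Γ) A) (u : Tm C Γ B) : Tm C Γ A :=
  b.subst (Subst.single u)

/-! ### Beta-reduction and observational equivalence -/

/-- One step of beta-reduction, at any position. -/
inductive Step {C : Type*} : {Γ : Ctx} → {A : Ty} → Tm C Γ A → Tm C Γ A → Prop
  | beta {Γ : Ctx} {A B : Ty} (b : Tm C (A :: Γ) B) (u : Tm C Γ A) :
      Step (.app (.lam b) u) (b.inst u)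
  | appL {Γ : Ctx} {A B : Ty} {f f' : Tm C Γ (Ty.arr A B)} (u : Tm C Γ A) :
      Step f f' → Step (.app f u) (.app f' u)
  | appR {Γ : Ctx} {A B : Ty} (f : Tm C Γ (Ty.arr A B)) {u u' : Tm C Γ A} :
      Step u u' → Step (.app f u) (.app f u')
  | lam {Γ : Ctx} {A B : Ty} {b b' : Tm C (A :: Γ) B} :
      Step b b' → Step (.lam b) (.lam b')

/-- Beta-equality. -/
def BetaEq {C : Type*} {Γ : Ctx} {A : Ty} : Tm C Γ A → Tm C Γ A → Prop :=
  Relation.EqvGen Step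

/-- `v` is the (beta-)normal form of `t`. -/
def IsNormalFormOf {C : Type*} {Γ : Ctx} {A : Ty} (v t : Tm C Γ A) : Prop :=
  Relation.ReflTransGen Step t v ∧ ∀ v' : Tm C Γ A, ¬ Step v v'

/-- Observational equivalence of closed terms: beta-equality at ground type, and at type `A → B`
equivalence of the applications to every closed term of type `A`. -/
def ObsEq {C : Type*} : {A : Ty} → Closed C A → Closed C A → Prop
  | Ty.o, t, t' => BetaEq t t'
  | Ty.arr A _, t, t' => ∀ u : Closed C A, ObsEq (Tm.app t u) (Tm.app t' u)

/-! ### Eta-long forms -/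

/-- A term which is of ground type or an abstraction. -/
inductive Tm.Saturated {C : Type*} : {Γ : Ctx} → {A : Ty} → Tm C Γ A → Prop
  | ground {Γ : Ctx} (t : Tm C Γ Ty.o) : Tm.Saturated t
  | lam {Γ : Ctx} {A B : Ty} (b : Tm C (A :: Γ) B) : Tm.Saturated (.lam b)

/-- Every argument of an application and every body of an abstraction in the term is of ground type
or an abstraction. -/
def Tm.InnerLong {C : Type*} : {Γ : Ctx} → {A : Ty} → Tm C Γ A → Prop
  | _, _, .var _ => True
  | _, _, .const _ => True
  | _, _, .app f a => f.InnerLong ∧ a.InnerLong ∧ a.Saturated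
  | _, _, .lam b => b.InnerLong ∧ b.Saturated

/-- Eta-long forms (of not necessarily normal terms): every subterm which is not in function
position is of ground type or an abstraction. -/
def Tm.EtaLong {C : Type*} {Γ : Ctx} {A : Ty} (t : Tm C Γ A) : Prop :=
  t.InnerLong ∧ t.Saturated

/-- Full eta-expansion, by recursion on the type. -/
def Tm.etaExpand {C : Type*} : {Γ : Ctx} → (A : Ty) → Tm C Γ A → Tm C Γ A
  | _, Ty.o, t => t
  | _, Ty.arr A B, t =>
      .lam (Tm.etaExpand B (.app (t.weaken A) (Tm.etaExpand A (.var Var.vz))))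

/-- The eta-long form of the identity `λ x. x` of type `A → A`. -/
def etaId (C : Type*) (A : Ty) : Closed C (Ty.arr A A) :=
  .lam (Tm.etaExpand A (.var Var.vz))

/-! ### Cells and cellular terms -/

/-- A list `C₁, …, C_p` of eta-long terms over `Δ` that can be given as arguments to a term of
type `A = B₁ → … → B_p → o`, so as to obtain a term of ground type. -/
inductive Args (C : Type*) (Δ : Ctx) : Ty → Type _
  | nil : Args C Δ Ty.o
  | cons {B A : Ty} (c : Tm C Δ B) (hc : c.EtaLong) (s : Args C Δ A) : Args C Δ (Ty.arr B A)

/-- The term `h C₁[σ] … C_p[σ]`. -/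
def Args.apply {C : Type*} {Γ Δ : Ctx} (σ : Subst C Δ Γ) :
    {A : Ty} → Args C Δ A → Tm C Γ A → Tm C Γ Ty.o
  | _, .nil, h => h
  | _, .cons c _ s, h => s.apply σ (.app h (c.subst σ))

/-- A cell `Σ[ ]₁ … [ ]_K = y (C₁[ ]₁ … [ ]_K) … (C_p[ ]₁ … [ ]_K)` whose free variable `y` is in
`Γ`. The holes, which are of ground type, are the variables of the context `Δ`; they are the only
variables allowed to occur free in the `C_i`. -/
structure Cell (C : Type*) (Γ Δ : Ctx) where
  ground : ∀ B ∈ Δ, B = Ty.o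
  headTy : Ty
  head : Var Γ headTy
  args : Args C Δ headTy

/-- `Σ[w₁] … [w_K]`: the holes are filled without capture, that is, by substitution. -/
def Cell.fill {C : Type*} {Γ Δ : Ctx} (S : Cell C Γ Δ) (w : Subst C Δ Γ) : Tm C Γ Ty.o :=
  S.args.apply w (.var S.head)

/-- `CellularIn t`, for `t` in the context `Γ = y₁, …, y_m`, says that `λ y₁ … y_m. t` is cellular:
after all the leading abstractions, one finds a constant, or a cell whose free variable is one of
the abstracted variables, filled with terms of ground type having the same property. -/
inductive CellularIn {C : Type*} : {Γ : Ctx} → {A : Ty} → Tm C Γ A → Prop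
  | lam {Γ : Ctx} {A B : Ty} {b : Tm C (A :: Γ) B} : CellularIn b → CellularIn (.lam b)
  | const {Γ : Ctx} (a : C) : CellularIn (.const a : Tm C Γ Ty.o)
  | cell {Γ Δ : Ctx} (S : Cell C Γ Δ) (w : Subst C Δ Γ) :
      (∀ (B : Ty) (x : Var Δ B), CellularIn (w B x)) → CellularIn (S.fill w)

/-- Cellular terms. -/
def Cellular {C : Type*} {A : Ty} (t : Closed C A) : Prop := CellularIn t

end STLC

/-! Work in the model `Den` of closed terms modulo observational equivalence. By strong induction on
the size of `A = A₁ → … → A_n → o`, the open term `y x₁ … x_n` is shown to have the same denotation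
as a cellular one (`hasCellularId`); abstracting its variables gives `t`.

By `isCellular_eval`, every ground term over `Γ` denotes a cellular function of the environment,
provided the argument types of the variables of `Γ` have cellular identities. The proof uses the
logical predicate `IsExpressible`, and the only real case is a variable applied to expressible
arguments. Such an application would be a filled cell if its arguments were eta-long terms with
ground holes filled by cellular functions (`IsFilled`). An arbitrary argument `D` is brought to that
case by writing it as the cellular identity of its type applied to `D`, and recursing on the body of
that identity (`CellularIn.isReplaceable`).

The crucial case is a cell headed by `D` itself. With ground holes, `D` can only select a hole or
return a constant (`Args.den_eq`). If it selects the filling `h`, then under a ground-valued `G` one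
may replace `h` by the constant function returning `G h` (`Den.app_eq_of_returns`), and this
function is a filled term with one hole.

The same selection principle, applied syntactically from the innermost cells outward, shows that the
normal form of `t w` is cellular (`CellularIn.exists_normal`). -/

namespace STLC

variable {C : Type*}

/-! ### Substitution calculus -/

theorem Subst.lift_var {Γ : Ctx} (B : Ty) :
    Subst.lift (fun (A : Ty) (x : Var Γ A) => (Tm.var x : Tm C Γ A)) B = fun _ x => Tm.var x := by
  funext A x; cases x <;> rfl

theorem Ren.lift_comp {Γ Δ Θ : Ctx} (ρ : Ren Γ Δ) (ρ' : Ren Δ Θ) (B : Ty) :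
    Ren.lift (fun A x => ρ' A (ρ A x)) B = fun A x => ρ'.lift B A (ρ.lift B A x) := by
  funext A x; cases x <;> rfl

theorem Tm.subst_var {Γ : Ctx} {A : Ty} (t : Tm C Γ A) :
    t.subst (fun _ x => .var x) = t := by
  induction t with
  | var x => rfl
  | const a => rfl
  | app f a hf ha => simp [Tm.subst, hf, ha]
  | lam b hb => simp [Tm.subst, Subst.lift_var, hb]

theorem Tm.rename_rename {Γ Δ Θ : Ctx} {A : Ty} (t : Tm C Γ A) (ρ : Ren Γ Δ) (ρ' : Ren Δ Θ) :
    (t.rename ρ).rename ρ' = t.rename (fun A x => ρ' A (ρ A x)) := by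
  induction t generalizing Δ Θ with
  | var x => rfl
  | const a => rfl
  | app f a hf ha => simp [Tm.rename, hf, ha]
  | lam b hb => simp [Tm.rename, Ren.lift_comp, hb]

theorem Tm.subst_rename {Γ Δ Θ : Ctx} {A : Ty} (t : Tm C Γ A) (ρ : Ren Γ Δ) (σ : Subst C Δ Θ) :
    (t.rename ρ).subst σ = t.subst (fun A x => σ A (ρ A x)) := by
  induction t generalizing Δ Θ with
  | var x => rfl
  | const a => rfl
  | app f a hf ha => simp [Tm.rename, Tm.subst, hf, ha]
  | lam b hb =>
    simp only [Tm.rename, Tm.subst, hb, Tm.lam.injEq]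
    congr 1
    funext A x; cases x <;> rfl

theorem Tm.rename_eq_subst {Γ Δ : Ctx} {A : Ty} (t : Tm C Γ A) (ρ : Ren Γ Δ) :
    t.rename ρ = t.subst (fun A x => .var (ρ A x)) := by
  rw [← Tm.subst_var (t.rename ρ), Tm.subst_rename]

theorem Tm.weaken_rename {Γ Δ : Ctx} {A : Ty} (t : Tm C Γ A) (ρ : Ren Γ Δ) (B : Ty) :
    (t.weaken B).rename (ρ.lift B) = (t.rename ρ).weaken B := by
  simp only [Tm.weaken, Tm.rename_rename]; rfl

theorem Tm.rename_subst {Γ Δ Θ : Ctx} {A : Ty} (t : Tm C Γ A) (σ : Subst C Γ Δ) (ρ : Ren Δ Θ) :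
    (t.subst σ).rename ρ = t.subst (fun A x => (σ A x).rename ρ) := by
  induction t generalizing Δ Θ with
  | var x => rfl
  | const a => rfl
  | app f a hf ha => simp [Tm.rename, Tm.subst, hf, ha]
  | lam b hb =>
    simp only [Tm.rename, Tm.subst, hb, Tm.lam.injEq]
    congr 1
    funext A x
    cases x with
    | vz => rfl
    | vs x => exact Tm.weaken_rename _ _ _

theorem Tm.weaken_subst {Γ Δ : Ctx} {A : Ty} (t : Tm C Γ A) (σ : Subst C Γ Δ) (B : Ty) :
    (t.weaken B).subst (σ.lift B) = (t.subst σ).weaken B := by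
  simp only [Tm.weaken, Tm.subst_rename, Tm.rename_subst]; rfl

theorem Tm.subst_subst {Γ Δ Θ : Ctx} {A : Ty} (t : Tm C Γ A) (σ : Subst C Γ Δ)
    (τ : Subst C Δ Θ) : (t.subst σ).subst τ = t.subst (fun A x => (σ A x).subst τ) := by
  induction t generalizing Δ Θ with
  | var x => rfl
  | const a => rfl
  | app f a hf ha => simp [Tm.subst, hf, ha]
  | lam b hb =>
    simp only [Tm.subst, hb, Tm.lam.injEq]
    congr 1
    funext A x
    cases x with
    | vz => rfl
    | vs x => exact Tm.weaken_subst _ _ _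

/-- The substitution extending `σ` by `u` for the last variable. -/
def Subst.cons {Γ Δ : Ctx} {B : Ty} (u : Tm C Δ B) (σ : Subst C Γ Δ) : Subst C (B :: Γ) Δ
  | _, .vz => u
  | _, .vs x => σ _ x

theorem Tm.weaken_inst {Γ : Ctx} {A B : Ty} (t : Tm C Γ A) (u : Tm C Γ B) :
    (t.weaken B).inst u = t := by
  simp only [Tm.weaken, Tm.inst, Tm.subst_rename]
  exact t.subst_var

theorem Tm.subst_lift_inst {Γ Δ : Ctx} {A B : Ty} (b : Tm C (B :: Γ) A) (σ : Subst C Γ Δ)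
    (u : Tm C Δ B) : (b.subst (σ.lift B)).inst u = b.subst (Subst.cons u σ) := by
  simp only [Tm.inst, Tm.subst_subst]
  congr 1
  funext A x
  cases x with
  | vz => rfl
  | vs x => exact Tm.weaken_inst _ _

theorem Tm.inst_subst {Γ Δ : Ctx} {A B : Ty} (b : Tm C (B :: Γ) A) (u : Tm C Γ B)
    (σ : Subst C Γ Δ) : (b.inst u).subst σ = (b.subst (σ.lift B)).inst (u.subst σ) := by
  rw [Tm.subst_lift_inst, Tm.inst, Tm.subst_subst]
  congr 1
  funext A x
  cases x <;> rfl

theorem Tm.subst_closed {A : Ty} (t : Closed C A) (σ : Subst C [] []) : t.subst σ = t := by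
  have : σ = fun _ x => .var x := by funext A x; cases x
  rw [this, Tm.subst_var]

/-- A closed term, in an arbitrary context. -/
def Tm.lift {A : Ty} (t : Closed C A) (Γ : Ctx) : Tm C Γ A := t.rename (fun (B : Ty) (x : Var [] B) => nomatch x)

theorem Tm.lift_subst {Γ Δ : Ctx} {A : Ty} (t : Closed C A) (σ : Subst C Γ Δ) :
    (t.lift Γ).subst σ = t.lift Δ := by
  rw [Tm.lift, Tm.lift, Tm.subst_rename, Tm.rename_eq_subst]
  congr 1
  funext A x; cases x

theorem Tm.lift_rename {Γ Δ : Ctx} {A : Ty} (t : Closed C A) (ρ : Ren Γ Δ) :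
    (t.lift Γ).rename ρ = t.lift Δ := by
  rw [Tm.rename_eq_subst, Tm.lift_subst]

theorem Tm.lift_nil {A : Ty} (t : Closed C A) : t.lift [] = t := by
  rw [Tm.lift, Tm.rename_eq_subst, Tm.subst_closed]

/-! ### Reduction -/

/-- Many-step beta-reduction. -/
abbrev Reds {Γ : Ctx} {A : Ty} : Tm C Γ A → Tm C Γ A → Prop := Relation.ReflTransGen Step

theorem Step.subst {Γ Δ : Ctx} {A : Ty} {t t' : Tm C Γ A} (h : Step t t') (σ : Subst C Γ Δ) :
    Step (t.subst σ) (t'.subst σ) := by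
  induction h generalizing Δ with
  | beta b u => rw [Tm.inst_subst]; exact .beta _ _
  | appL u _ ih => exact .appL _ (ih σ)
  | appR f _ ih => exact .appR _ (ih σ)
  | lam _ ih => exact .lam (ih _)

theorem Reds.subst {Γ Δ : Ctx} {A : Ty} {t t' : Tm C Γ A} (h : Reds t t') (σ : Subst C Γ Δ) :
    Reds (t.subst σ) (t'.subst σ) :=
  h.lift (fun t => Tm.subst σ t) (fun _ _ h => h.subst σ)

theorem Reds.rename {Γ Δ : Ctx} {A : Ty} {t t' : Tm C Γ A} (h : Reds t t') (ρ : Ren Γ Δ) :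
    Reds (t.rename ρ) (t'.rename ρ) := by
  simp only [Tm.rename_eq_subst]
  exact h.subst _

theorem Reds.app {Γ : Ctx} {A B : Ty} {f f' : Tm C Γ (.arr A B)} {a a' : Tm C Γ A}
    (hf : Reds f f') (ha : Reds a a') : Reds (.app f a) (.app f' a') :=
  (hf.lift (fun f => Tm.app f a) (fun _ _ h => Step.appL a h)).trans
    (ha.lift (fun a => Tm.app f' a) (fun _ _ h => Step.appR f' h))

theorem Reds.lam {Γ : Ctx} {A B : Ty} {b b' : Tm C (A :: Γ) B} (h : Reds b b') :
    Reds (.lam b) (.lam b') :=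
  h.lift (fun b => Tm.lam b) (fun _ _ h => Step.lam h)

theorem Tm.subst_reds {Γ Δ : Ctx} {A : Ty} (t : Tm C Γ A) {σ σ' : Subst C Γ Δ}
    (h : ∀ A x, Reds (σ A x) (σ' A x)) : Reds (t.subst σ) (t.subst σ') := by
  induction t generalizing Δ with
  | var x => exact h _ x
  | const a => exact .refl
  | app f a hf ha => exact (hf h).app (ha h)
  | lam b hb =>
    refine Reds.lam (hb fun A x => ?_)
    cases x with
    | vz => exact .refl
    | vs x => exact (h _ x).rename _

theorem Step.betaEq {Γ : Ctx} {A : Ty} {t t' : Tm C Γ A} (h : Step t t') : BetaEq t t' :=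
  Relation.EqvGen.rel _ _ h

/-! ### Observational equivalence is a congruence -/

/-- The binary logical relation over beta-equality of closed ground terms. -/
def LogEq : {A : Ty} → Closed C A → Closed C A → Prop
  | .o, t, t' => BetaEq t t'
  | .arr _ _, t, t' => ∀ u u', LogEq u u' → LogEq (.app t u) (.app t' u')

theorem LogEq.symm {A : Ty} {t t' : Closed C A} (h : LogEq t t') : LogEq t' t := by
  induction A with
  | o => exact Relation.EqvGen.symm _ _ h
  | arr A B ihA ihB => exact fun u u' hu => ihB (h _ _ (ihA hu))

theorem LogEq.trans {A : Ty} {t t' t'' : Closed C A} (h : LogEq t t') (h' : LogEq t' t'') :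
    LogEq t t'' := by
  induction A with
  | o => exact Relation.EqvGen.trans _ _ _ h h'
  -- Reflexivity is not yet available; symmetry and transitivity at `A` relate `u'` to itself.
  | arr A B ihA ihB => exact fun u u' hu => ihB (h _ _ hu) (h' _ _ (ihA hu.symm hu))

theorem LogEq.of_step {A : Ty} {t t' s : Closed C A} (h : Step t t') (h' : LogEq t' s) :
    LogEq t s := by
  induction A with
  | o => exact Relation.EqvGen.trans _ _ _ h.betaEq h'
  | arr A B ihA ihB => exact fun u u' hu => ihB (.appL _ h) (h' _ _ hu)

/-- Fundamental lemma of the logical relation; the abstraction case rests on closure under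
beta-expansion (`LogEq.of_step`). -/
theorem Tm.subst_logEq {Γ : Ctx} {A : Ty} (t : Tm C Γ A) {σ σ' : Subst C Γ []}
    (h : ∀ A x, LogEq (σ A x) (σ' A x)) : LogEq (t.subst σ) (t.subst σ') := by
  induction t with
  | var x => exact h _ x
  | const a => exact Relation.EqvGen.refl _
  | app f a hf ha => exact hf h _ _ (ha h)
  | lam b hb =>
    intro u u' hu
    refine LogEq.of_step (.beta _ _) (LogEq.symm (LogEq.of_step (.beta _ _) (LogEq.symm ?_)))
    rw [Tm.subst_lift_inst, Tm.subst_lift_inst]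
    refine hb fun A x => ?_
    cases x with
    | vz => exact hu
    | vs x => exact h _ x

theorem LogEq.refl {A : Ty} (t : Closed C A) : LogEq t t := by
  have := t.subst_logEq (σ := fun _ x => .var x) (σ' := fun _ x => .var x) (fun _ => nofun)
  rwa [Tm.subst_var] at this

/-- Observational equivalence tests both terms on the same argument, the logical relation on related
arguments. Reflexivity of the latter bridges the gap, so application descends to the quotient. -/
theorem obsEq_iff_logEq {A : Ty} {t t' : Closed C A} : ObsEq t t' ↔ LogEq t t' := by
  induction A with
  | o => exact Iff.rfl
  | arr A B ihA ihB =>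
    refine ⟨fun h u u' hu => ?_, fun h u => ihB.2 (h _ _ (LogEq.refl u))⟩
    exact (ihB.1 (h u)).trans (LogEq.refl t' _ _ hu)

/-! ### The minimal model -/

/-- Observational equivalence as a setoid. -/
def obsSetoid (C : Type*) (A : Ty) : Setoid (Closed C A) where
  r := ObsEq
  iseqv := ⟨fun t => obsEq_iff_logEq.2 (.refl t), fun h => obsEq_iff_logEq.2 (obsEq_iff_logEq.1 h).symm,
    fun h h' => obsEq_iff_logEq.2 ((obsEq_iff_logEq.1 h).trans (obsEq_iff_logEq.1 h'))⟩

/-- The minimal model: closed terms up to observational equivalence. -/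
def Den (C : Type*) (A : Ty) : Type _ := Quotient (obsSetoid C A)

/-- The class of a closed term. -/
def Den.mk {A : Ty} (t : Closed C A) : Den C A := Quotient.mk (obsSetoid C A) t

/-- A representative of a class. -/
noncomputable def Den.rep {A : Ty} (d : Den C A) : Closed C A := Quotient.out d

theorem Den.mk_rep {A : Ty} (d : Den C A) : Den.mk d.rep = d := Quotient.out_eq d

theorem Den.mk_eq {A : Ty} {t t' : Closed C A} : Den.mk t = Den.mk t' ↔ ObsEq t t' :=
  ⟨fun h => Quotient.exact h, fun h => Quotient.sound h⟩

theorem Den.mk_eq_iff_logEq {A : Ty} {t t' : Closed C A} : Den.mk t = Den.mk t' ↔ LogEq t t' :=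
  Den.mk_eq.trans obsEq_iff_logEq

/-- Application in the minimal model. -/
def Den.app {A B : Ty} (f : Den C (.arr A B)) (a : Den C A) : Den C B :=
  Quotient.liftOn₂ f a (fun t u => Den.mk (.app t u)) fun _ _ _ _ h h' =>
    Den.mk_eq_iff_logEq.2 (obsEq_iff_logEq.1 h _ _ (obsEq_iff_logEq.1 h'))

theorem Den.mk_app {A B : Ty} (f : Closed C (.arr A B)) (a : Closed C A) :
    Den.mk (.app f a) = (Den.mk f).app (Den.mk a) := rfl

theorem Den.ext {A B : Ty} {f g : Den C (.arr A B)} (h : ∀ a, f.app a = g.app a) : f = g := by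
  rw [← f.mk_rep, ← g.mk_rep] at h ⊢
  exact Den.mk_eq.2 fun u => Den.mk_eq.1 (h (Den.mk u))

/-- Environments in the minimal model. -/
abbrev Env (C : Type*) (Γ : Ctx) : Type _ := ∀ A : Ty, Var Γ A → Den C A

/-- Extension of an environment. -/
def Env.cons {Γ : Ctx} {B : Ty} (d : Den C B) (ρ : Env C Γ) : Env C (B :: Γ)
  | _, .vz => d
  | _, .vs x => ρ _ x

/-- Restriction of an environment. -/
def Env.tail {Γ : Ctx} {B : Ty} (ρ : Env C (B :: Γ)) : Env C Γ := fun _ x => ρ _ (.vs x)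

theorem Env.cons_tail {Γ : Ctx} {B : Ty} (ρ : Env C (B :: Γ)) : Env.cons (ρ _ .vz) ρ.tail = ρ := by
  funext A x; cases x <;> rfl

/-- The empty environment. -/
def Env.nil : Env C [] := fun _ => nofun

/-- Interpretation of terms in the minimal model. -/
noncomputable def Tm.eval {Γ : Ctx} {A : Ty} (t : Tm C Γ A) (ρ : Env C Γ) : Den C A :=
  Den.mk (t.subst fun _ x => (ρ _ x).rep)

theorem Tm.mk_subst {Γ : Ctx} {A : Ty} (t : Tm C Γ A) (σ : Subst C Γ []) :
    Den.mk (t.subst σ) = t.eval (fun _ x => Den.mk (σ _ x)) :=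
  Den.mk_eq_iff_logEq.2 (t.subst_logEq fun _ _ => Den.mk_eq_iff_logEq.1 (Den.mk_rep _).symm)

@[simp] theorem Tm.eval_var {Γ : Ctx} {A : Ty} (x : Var Γ A) (ρ : Env C Γ) :
    (Tm.var x).eval ρ = ρ A x := Den.mk_rep _

@[simp] theorem Tm.eval_const {Γ : Ctx} (a : C) (ρ : Env C Γ) :
    (Tm.const a : Tm C Γ .o).eval ρ = Den.mk (.const a) := rfl

@[simp] theorem Tm.eval_app {Γ : Ctx} {A B : Ty} (f : Tm C Γ (.arr A B)) (a : Tm C Γ A)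
    (ρ : Env C Γ) : (Tm.app f a).eval ρ = (f.eval ρ).app (a.eval ρ) := rfl

@[simp] theorem Tm.eval_lam_app {Γ : Ctx} {A B : Ty} (b : Tm C (A :: Γ) B) (ρ : Env C Γ)
    (d : Den C A) : ((Tm.lam b).eval ρ).app d = b.eval (Env.cons d ρ) := by
  rw [← d.mk_rep]
  refine Den.mk_eq_iff_logEq.2 (LogEq.of_step (.beta _ _) ?_)
  rw [Tm.subst_lift_inst]
  refine b.subst_logEq fun A x => Den.mk_eq_iff_logEq.1 ?_
  cases x with
  | vz => exact (Den.mk_rep _).symm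
  | vs x => rfl

theorem Tm.eval_subst {Γ Δ : Ctx} {A : Ty} (t : Tm C Γ A) (σ : Subst C Γ Δ) (ρ : Env C Δ) :
    (t.subst σ).eval ρ = t.eval (fun _ x => (σ _ x).eval ρ) := by
  rw [Tm.eval, Tm.subst_subst, Tm.mk_subst]; rfl

theorem Tm.eval_rename {Γ Δ : Ctx} {A : Ty} (t : Tm C Γ A) (ι : Ren Γ Δ) (ρ : Env C Δ) :
    (t.rename ι).eval ρ = t.eval (fun _ x => ρ _ (ι _ x)) := by
  simp [Tm.rename_eq_subst, Tm.eval_subst]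

@[simp] theorem Tm.eval_weaken {Γ : Ctx} {A B : Ty} (t : Tm C Γ A) (d : Den C B) (ρ : Env C Γ) :
    (t.weaken B).eval (Env.cons d ρ) = t.eval ρ := Tm.eval_rename _ _ _

theorem Tm.eval_closed {A : Ty} (t : Closed C A) (ρ : Env C []) : t.eval ρ = Den.mk t := by
  rw [Tm.eval, Tm.subst_closed]

@[simp] theorem Tm.eval_lift {Γ : Ctx} {A : Ty} (t : Closed C A) (ρ : Env C Γ) :
    (t.lift Γ).eval ρ = Den.mk t := by
  rw [Tm.lift, Tm.eval_rename, Tm.eval_closed]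

theorem Tm.eval_inst {Γ : Ctx} {A B : Ty} (b : Tm C (A :: Γ) B) (u : Tm C Γ A) (ρ : Env C Γ) :
    (b.inst u).eval ρ = b.eval (Env.cons (u.eval ρ) ρ) := by
  rw [Tm.inst, Tm.eval_subst]
  congr 1
  funext A x
  cases x
  · rfl
  · exact Tm.eval_var _ _

theorem Step.eval_eq {Γ : Ctx} {A : Ty} {t t' : Tm C Γ A} (h : Step t t') (ρ : Env C Γ) :
    t.eval ρ = t'.eval ρ := by
  induction h with
  | beta b u => rw [Tm.eval_app, Tm.eval_lam_app, Tm.eval_inst]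
  | appL u _ ih => simp [ih]
  | appR f _ ih => simp [ih]
  | lam _ ih => exact Den.ext fun d => by simp [ih]

theorem Reds.eval_eq {Γ : Ctx} {A : Ty} {t t' : Tm C Γ A} (h : Reds t t') (ρ : Env C Γ) :
    t.eval ρ = t'.eval ρ := by
  induction h with
  | refl => rfl
  | tail _ h ih => rw [ih, h.eval_eq]

/-! ### Normal forms -/

/-- Abstractions. -/
def Tm.IsLam : {Γ : Ctx} → {A : Ty} → Tm C Γ A → Prop
  | _, _, .lam _ => True
  | _, _, _ => False

/-- Normal terms, by recursion on the term. -/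
def Tm.Normal : {Γ : Ctx} → {A : Ty} → Tm C Γ A → Prop
  | _, _, .var _ => True
  | _, _, .const _ => True
  | _, _, .app f a => f.Normal ∧ ¬ f.IsLam ∧ a.Normal
  | _, _, .lam b => b.Normal

theorem Tm.not_isLam_of_ground {Γ : Ctx} (t : Tm C Γ .o) : ¬ t.IsLam := by
  cases t <;> exact id

theorem Tm.Normal.not_step {Γ : Ctx} {A : Ty} {t t' : Tm C Γ A} (h : t.Normal) : ¬ Step t t' := by
  intro hs
  induction hs with
  | beta b u => exact h.2.1 trivial
  | appL u _ ih => exact ih h.1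
  | appR f _ ih => exact ih h.2.2
  | lam _ ih => exact ih h

theorem Tm.Normal.rename {Γ Δ : Ctx} {A : Ty} {t : Tm C Γ A} (h : t.Normal) (ρ : Ren Γ Δ) :
    (t.rename ρ).Normal ∧ (¬ t.IsLam → ¬ (t.rename ρ).IsLam) := by
  induction t generalizing Δ with
  | var x => exact ⟨trivial, id⟩
  | const a => exact ⟨trivial, id⟩
  | app f a hf ha => exact ⟨⟨(hf h.1 ρ).1, (hf h.1 ρ).2 h.2.1, (ha h.2.2 ρ).1⟩, fun _ => id⟩
  | lam b hb => exact ⟨(hb h _).1, fun h => (h trivial).elim⟩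

theorem Tm.Normal.subst {Γ Δ : Ctx} {A : Ty} {t : Tm C Γ A} (h : t.Normal) {σ : Subst C Γ Δ}
    (hσ : ∀ A x, (σ A x).Normal ∧ ¬ (σ A x).IsLam) :
    (t.subst σ).Normal ∧ (¬ t.IsLam → ¬ (t.subst σ).IsLam) := by
  induction t generalizing Δ with
  | var x => exact ⟨(hσ _ x).1, fun _ => (hσ _ x).2⟩
  | const a => exact ⟨trivial, id⟩
  | app f a hf ha =>
    exact ⟨⟨(hf h.1 hσ).1, (hf h.1 hσ).2 h.2.1, (ha h.2.2 hσ).1⟩, fun _ => id⟩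
  | lam b hb =>
    refine ⟨(hb (σ := σ.lift _) h fun A x => ?_).1, fun h => (h trivial).elim⟩
    cases x with
    | vz => exact ⟨trivial, id⟩
    | vs x => exact ⟨((hσ _ x).1.rename _).1, ((hσ _ x).1.rename _).2 (hσ _ x).2⟩

/-- Terms that reduce to a normal term. -/
def Tm.WN {Γ : Ctx} {A : Ty} (t : Tm C Γ A) : Prop := ∃ v, Reds t v ∧ v.Normal

/-- Reducible terms. -/
def Tm.Reducible : {Γ : Ctx} → {A : Ty} → Tm C Γ A → Prop
  | _, .o, t => t.WN
  | Γ, .arr A _, t => t.WN ∧ ∀ (Δ : Ctx) (ρ : Ren Γ Δ) (u : Tm C Δ A), u.Reducible →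
      (Tm.app (t.rename ρ) u).Reducible

theorem Tm.Reducible.wn {Γ : Ctx} {A : Ty} {t : Tm C Γ A} (h : t.Reducible) : t.WN := by
  cases A with
  | o => exact h
  | arr A B => exact h.1

theorem Tm.WN.of_reds {Γ : Ctx} {A : Ty} {t t' : Tm C Γ A} (h : Reds t t') (h' : t'.WN) : t.WN :=
  let ⟨v, hv, n⟩ := h'
  ⟨v, h.trans hv, n⟩

theorem Tm.Reducible.of_reds {Γ : Ctx} {A : Ty} {t t' : Tm C Γ A} (h : Reds t t')
    (h' : t'.Reducible) : t.Reducible := by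
  induction A generalizing Γ with
  | o => exact Tm.WN.of_reds h h'
  | arr A B ihA ihB =>
    exact ⟨Tm.WN.of_reds h h'.1, fun Δ ρ u hu => ihB ((h.rename ρ).app .refl) (h'.2 Δ ρ u hu)⟩

/-- A normal term that is not an abstraction creates no redex when applied to a normal argument. In
particular variables are reducible, which allows normalization under binders. -/
theorem Tm.Reducible.of_neutral {Γ : Ctx} {A : Ty} {t : Tm C Γ A} (h : t.Normal) (hl : ¬ t.IsLam) :
    t.Reducible := by
  induction A generalizing Γ with
  | o => exact ⟨t, .refl, h⟩
  | arr A B ihA ihB =>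
    refine ⟨⟨t, .refl, h⟩, fun Δ ρ u hu => ?_⟩
    obtain ⟨v, hv, n⟩ := hu.wn
    exact Tm.Reducible.of_reds (Reds.app .refl hv)
      (ihB ⟨(h.rename ρ).1, (h.rename ρ).2 hl, n⟩ id)

theorem Tm.Reducible.rename {Γ Δ : Ctx} {A : Ty} {t : Tm C Γ A} (h : t.Reducible) (ρ : Ren Γ Δ) :
    (t.rename ρ).Reducible := by
  have wn : t.WN → (t.rename ρ).WN := fun ⟨v, hv, n⟩ => ⟨_, hv.rename ρ, (n.rename ρ).1⟩
  cases A with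
  | o => exact wn h
  | arr A B =>
    refine ⟨wn h.1, fun Θ ρ' u hu => ?_⟩
    rw [Tm.rename_rename]
    exact h.2 _ _ _ hu

theorem Tm.reducible_subst {Γ Δ : Ctx} {A : Ty} (t : Tm C Γ A) {σ : Subst C Γ Δ}
    (hσ : ∀ A x, (σ A x).Reducible) : (t.subst σ).Reducible := by
  induction t generalizing Δ with
  | var x => exact hσ _ x
  | const a => exact ⟨_, .refl, trivial⟩
  | app f a hf ha =>
    have := (hf hσ).2 _ (fun _ x => x) _ (ha hσ)
    rwa [Tm.rename_eq_subst, Tm.subst_var] at this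
  | lam b hb =>
    constructor
    · have : (b.subst (σ.lift _)).Reducible := hb fun A x => by
        cases x with
        | vz => exact .of_neutral trivial id
        | vs x => exact (hσ _ x).rename _
      obtain ⟨v, hv, n⟩ := this.wn
      exact ⟨_, hv.lam, n⟩
    · intro Θ ρ u hu
      rw [Tm.rename_subst]
      refine .of_reds (.single (.beta _ _)) ?_
      rw [Tm.subst_lift_inst]
      refine hb fun A x => ?_
      cases x with
      | vz => exact hu
      | vs x => exact (hσ _ x).rename ρ

theorem Tm.exists_normal {Γ : Ctx} {A : Ty} (t : Tm C Γ A) : ∃ v, Reds t v ∧ v.Normal := by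
  have := (t.reducible_subst (σ := fun _ x => .var x) fun _ _ => .of_neutral trivial id).wn
  rwa [Tm.subst_var] at this

/-! ### Eta-long terms -/

theorem Tm.InnerLong.rename {Γ Δ : Ctx} {A : Ty} {t : Tm C Γ A} (h : t.InnerLong) (ρ : Ren Γ Δ) :
    (t.rename ρ).InnerLong ∧ (t.Saturated → (t.rename ρ).Saturated) := by
  induction t generalizing Δ with
  | var x => exact ⟨trivial, fun h => by cases h; exact .ground _⟩
  | const a => exact ⟨trivial, fun _ => .ground _⟩
  | app f a hf ha =>
    exact ⟨⟨(hf h.1 ρ).1, (ha h.2.1 ρ).1, (ha h.2.1 ρ).2 h.2.2⟩, fun h => by cases h; exact .ground _⟩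
  | lam b hb => exact ⟨⟨(hb h.1 _).1, (hb h.1 _).2 h.2⟩, fun _ => .lam _⟩

theorem Tm.InnerLong.subst {Γ Δ : Ctx} {A : Ty} {t : Tm C Γ A} (h : t.InnerLong)
    {σ : Subst C Γ Δ} (hσ : ∀ A x, (σ A x).InnerLong) :
    (t.subst σ).InnerLong ∧ (t.Saturated → (t.subst σ).Saturated) := by
  induction t generalizing Δ with
  | var x => exact ⟨hσ _ x, fun h => by cases h; exact .ground _⟩
  | const a => exact ⟨trivial, fun _ => .ground _⟩
  | app f a hf ha =>
    exact ⟨⟨(hf h.1 hσ).1, (ha h.2.1 hσ).1, (ha h.2.1 hσ).2 h.2.2⟩,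
      fun h => by cases h; exact .ground _⟩
  | @lam _ B _ b hb =>
    have : ∀ D x, (σ.lift B D x).InnerLong := fun D x => by
      cases x with
      | vz => trivial
      | vs x => exact ((hσ _ x).rename _).1
    exact ⟨⟨(hb h.1 this).1, (hb h.1 this).2 h.2⟩, fun _ => .lam _⟩

theorem Tm.Saturated.step {Γ : Ctx} {A : Ty} {t t' : Tm C Γ A} (h : t.Saturated) (hs : Step t t') :
    t'.Saturated := by
  cases h with
  | ground => exact .ground _
  | lam b => cases hs; exact .lam _

theorem Tm.InnerLong.step {Γ : Ctx} {A : Ty} {t t' : Tm C Γ A} (h : t.InnerLong) (hs : Step t t') :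
    t'.InnerLong := by
  induction hs with
  | beta b u =>
    refine (h.1.1.subst fun A x => ?_).1
    cases x with
    | vz => exact h.2.1
    | vs x => trivial
  | appL u _ ih => exact ⟨ih h.1, h.2⟩
  | appR f hs ih => exact ⟨h.1, ih h.2.1, h.2.2.step hs⟩
  | lam hs ih => exact ⟨ih h.1, h.2.step hs⟩

theorem Tm.EtaLong.reds {Γ : Ctx} {A : Ty} {t t' : Tm C Γ A} (h : t.EtaLong) (hs : Reds t t') :
    t'.EtaLong := by
  induction hs with
  | refl => exact h
  | tail _ hs ih => exact ⟨ih.1.step hs, ih.2.step hs⟩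

theorem Tm.EtaLong.rename {Γ Δ : Ctx} {A : Ty} {t : Tm C Γ A} (h : t.EtaLong) (ρ : Ren Γ Δ) :
    (t.rename ρ).EtaLong := ⟨(h.1.rename ρ).1, (h.1.rename ρ).2 h.2⟩

theorem Tm.EtaLong.subst {Γ Δ : Ctx} {A : Ty} {t : Tm C Γ A} (h : t.EtaLong) {σ : Subst C Γ Δ}
    (hσ : ∀ A x, (σ A x).InnerLong) : (t.subst σ).EtaLong :=
  ⟨(h.1.subst hσ).1, (h.1.subst hσ).2 h.2⟩

theorem Tm.eval_etaExpand {Γ : Ctx} (A : Ty) (t : Tm C Γ A) (ρ : Env C Γ) :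
    (Tm.etaExpand A t).eval ρ = t.eval ρ := by
  induction A generalizing Γ with
  | o => rfl
  | arr A B ihA ihB =>
    refine Den.ext fun d => ?_
    simp [Tm.etaExpand, ihA, ihB, Env.cons]

/-! ### Cells -/

/-- Contexts all of whose types are ground. -/
def GroundCtx (Δ : Ctx) : Prop := ∀ B ∈ Δ, B = Ty.o

theorem Var.mem {Γ : Ctx} {A : Ty} (x : Var Γ A) : A ∈ Γ := by
  induction x with
  | vz => exact List.mem_cons_self
  | vs _ ih => exact List.mem_cons_of_mem _ ih

/-- Semantic counterpart of `Args.apply`. -/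
noncomputable def Args.den {Δ : Ctx} (δ : Env C Δ) : {A : Ty} → Args C Δ A → Den C A → Den C Ty.o
  | _, .nil, f => f
  | _, .cons c _ s, f => s.den δ (f.app (c.eval δ))

theorem Args.eval_apply {Γ Δ : Ctx} {A : Ty} (s : Args C Δ A) (σ : Subst C Δ Γ) (h : Tm C Γ A)
    (ρ : Env C Γ) : (s.apply σ h).eval ρ = s.den (fun _ x => (σ _ x).eval ρ) (h.eval ρ) := by
  induction s with
  | nil => rfl
  | cons c hc s ih => simp [Args.apply, Args.den, ih, Tm.eval_subst]

theorem Args.apply_subst {Γ Δ Θ : Ctx} {A : Ty} (s : Args C Δ A) (σ : Subst C Δ Γ) (h : Tm C Γ A)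
    (τ : Subst C Γ Θ) :
    (s.apply σ h).subst τ = s.apply (fun _ x => (σ _ x).subst τ) (h.subst τ) := by
  induction s with
  | nil => rfl
  | cons c hc s ih => simp [Args.apply, ih, Tm.subst, Tm.subst_subst]

theorem Args.apply_reds {Γ Δ : Ctx} {A : Ty} (s : Args C Δ A) {σ σ' : Subst C Δ Γ}
    (hσ : ∀ A x, Reds (σ A x) (σ' A x)) {h h' : Tm C Γ A} (hh : Reds h h') :
    Reds (s.apply σ h) (s.apply σ' h') := by
  induction s with
  | nil => exact hh
  | cons c hc s ih => exact ih (hh.app (c.subst_reds hσ))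

theorem Args.apply_innerLong {Γ Δ : Ctx} {A : Ty} (s : Args C Δ A) {σ : Subst C Δ Γ}
    (hσ : ∀ A x, (σ A x).InnerLong) {h : Tm C Γ A} (hh : h.InnerLong) :
    (s.apply σ h).InnerLong := by
  induction s with
  | nil => exact hh
  | cons c hc s ih => exact ih ⟨hh, hc.subst hσ⟩

/-- The arguments are normalized with their holes still open. Filling the holes with normal ground
terms creates no redex, so the result is normal and still visibly a filled cell. -/
theorem Args.exists_normal {Δ : Ctx} {A : Ty} (s : Args C Δ A) : ∃ s' : Args C Δ A,
    (∀ {Γ : Ctx} (σ : Subst C Δ Γ) (h : Tm C Γ A), Reds (s.apply σ h) (s'.apply σ h)) ∧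
    ∀ {Γ : Ctx} (σ : Subst C Δ Γ) (h : Tm C Γ A), (∀ A x, (σ A x).Normal ∧ ¬ (σ A x).IsLam) →
      h.Normal → ¬ h.IsLam → (s'.apply σ h).Normal := by
  induction s with
  | nil => exact ⟨.nil, fun _ _ => .refl, fun _ _ _ h _ => h⟩
  | cons c hc s ih =>
    obtain ⟨s', h1, h2⟩ := ih
    obtain ⟨c', hc', n⟩ := c.exists_normal
    refine ⟨.cons c' (hc.reds hc') s', fun σ h => ?_, fun σ h hσ hn hl => ?_⟩
    · exact (s.apply_reds (fun _ _ => .refl) (.app .refl (hc'.subst σ))).trans (h1 _ _)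
    · exact h2 _ _ hσ ⟨hn, hl, (n.subst hσ).1⟩ id

/-- A normal application would have a variable or a constant at its head, but here these all have
ground type and cannot be applied. -/
theorem GroundCtx.normal {Δ : Ctx} (hΔ : GroundCtx Δ) {A : Ty} {t : Tm C Δ A} (h : t.Normal)
    (hl : ¬ t.IsLam) : (∃ x, t = .var x) ∨ ∃ (hA : Ty.o = A) (a : C), t = hA ▸ .const a := by
  induction t with
  | var x => exact .inl ⟨x, rfl⟩
  | const a => exact .inr ⟨rfl, a, rfl⟩
  | app f a hf ha =>
    rcases hf hΔ h.1 h.2.1 with ⟨x, -⟩ | ⟨h, -⟩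
    · exact absurd (hΔ _ x.mem) (by simp)
    · simp at h
  | lam b _ => exact absurd trivial hl

theorem GroundCtx.exists_reds {Δ : Ctx} (hΔ : GroundCtx Δ) (t : Tm C Δ .o) :
    (∃ x, Reds t (.var x)) ∨ ∃ a, Reds t (.const a) := by
  obtain ⟨v, hv, n⟩ := t.exists_normal
  rcases hΔ.normal n v.not_isLam_of_ground with ⟨x, rfl⟩ | ⟨_, a, rfl⟩
  · exact .inl ⟨x, hv⟩
  · exact .inr ⟨a, hv⟩

/-- The application is normalized once over the holes, before filling, so the selected hole or
constant is the same for every filling. -/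
theorem Args.lift_reds {Δ : Ctx} {A : Ty} (s : Args C Δ A) (hΔ : GroundCtx Δ) (c : Closed C A) :
    (∃ x, ∀ {Γ : Ctx} (σ : Subst C Δ Γ), Reds (s.apply σ (c.lift Γ)) (σ _ x)) ∨
    ∃ a, ∀ {Γ : Ctx} (σ : Subst C Δ Γ), Reds (s.apply σ (c.lift Γ)) (.const a) := by
  have key : ∀ {Γ : Ctx} (σ : Subst C Δ Γ),
      (s.apply (fun _ x => .var x) (c.lift Δ)).subst σ = s.apply σ (c.lift Γ) := fun σ => by
    rw [Args.apply_subst, Tm.lift_subst]; rfl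
  rcases hΔ.exists_reds (s.apply (fun _ x => .var x) (c.lift Δ)) with ⟨x, h⟩ | ⟨a, h⟩
  · exact .inl ⟨x, fun σ => key σ ▸ h.subst σ⟩
  · exact .inr ⟨a, fun σ => key σ ▸ h.subst σ⟩

/-- With ground holes, closed arguments of an element of the model select a hole or a constant. -/
theorem Args.den_eq {Δ : Ctx} {A : Ty} (s : Args C Δ A) (hΔ : GroundCtx Δ) (d : Den C A) :
    (∃ x, ∀ δ, s.den δ d = δ _ x) ∨ ∃ a : Den C .o, ∀ δ, s.den δ d = a := by
  have key : ∀ δ : Env C Δ, s.den δ d = (s.apply (fun _ x => .var x) (d.rep.lift Δ)).eval δ :=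
    fun δ => by rw [Args.eval_apply, Tm.eval_lift, Den.mk_rep]; simp
  rcases s.lift_reds hΔ d.rep with ⟨x, h⟩ | ⟨a, h⟩
  · exact .inl ⟨x, fun δ => by rw [key, (h _).eval_eq, Tm.eval_var]⟩
  · exact .inr ⟨_, fun δ => by rw [key, (h _).eval_eq, Tm.eval_const]⟩

/-- Substituting closed terms for some variables of a cellular term yields a term whose normal form
is cellular. -/
theorem CellularIn.exists_normal {Γ Δ : Ctx} {A : Ty} {t : Tm C Γ A} (h : CellularIn t)
    (σ : Subst C Γ Δ)
    (hσ : ∀ A x, (∃ y, σ A x = .var y) ∨ ∃ c : Closed C A, σ A x = c.lift Δ) :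
    ∃ v, Reds (t.subst σ) v ∧ v.Normal ∧ CellularIn v := by
  induction h generalizing Δ with
  | lam _ ih =>
    obtain ⟨v, h, n, hc⟩ := ih (σ.lift _) fun A x => by
      cases x with
      | vz => exact .inl ⟨_, rfl⟩
      | vs x =>
        rcases hσ _ x with ⟨y, hy⟩ | ⟨c, hc⟩
        · exact .inl ⟨.vs y, by simp [Subst.lift, hy, Tm.weaken, Tm.rename]⟩
        · exact .inr ⟨c, by simp [Subst.lift, hc, Tm.weaken, Tm.lift_rename]⟩
    exact ⟨_, h.lam, n, hc.lam⟩
  | const a => exact ⟨_, .refl, trivial, .const a⟩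
  | cell S w _ ih =>
    -- The fillings are normalized first: a cell whose head becomes a closed term then collapses to
    -- one of these normal forms or to a constant.
    choose v h n hc using fun B x => ih B x σ hσ
    have hr : Reds ((S.fill w).subst σ) (S.args.apply v (σ _ S.head)) := by
      rw [Cell.fill, Args.apply_subst]
      exact S.args.apply_reds h .refl
    rcases hσ _ S.head with ⟨y, hy⟩ | ⟨c, hc'⟩
    · obtain ⟨s', h1, h2⟩ := S.args.exists_normal
      rw [hy] at hr
      refine ⟨_, hr.trans (h1 _ _), h2 _ _ (fun B x => ⟨n B x, ?_⟩) trivial id,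
        CellularIn.cell ⟨S.ground, S.headTy, y, s'⟩ v hc⟩
      obtain rfl := S.ground B x.mem
      exact Tm.not_isLam_of_ground _
    · rw [hc'] at hr
      rcases S.args.lift_reds S.ground c with ⟨x, hx⟩ | ⟨a, ha⟩
      · exact ⟨_, hr.trans (hx v), n _ x, hc _ x⟩
      · exact ⟨_, hr.trans (ha v), trivial, .const a⟩

/-! ### Iterated abstraction and application -/

/-- The type `A_n → … → A_1 → E`, for `Θ = A_1, …, A_n`. -/
def arrs : Ctx → Ty → Ty
  | [], E => E
  | A :: Θ, E => arrs Θ (.arr A E)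

theorem arrs_append (Θ : Ctx) (A E : Ty) : arrs (Θ ++ [A]) E = .arr A (arrs Θ E) := by
  induction Θ generalizing E with
  | nil => rfl
  | cons B Θ ih => exact ih _

theorem exists_arrs (A : Ty) : ∃ Θ, A = arrs Θ .o := by
  induction A with
  | o => exact ⟨[], rfl⟩
  | arr A B _ ih =>
    obtain ⟨Θ, rfl⟩ := ih
    exact ⟨Θ ++ [A], (arrs_append _ _ _).symm⟩

theorem sizeOf_le_arrs (Θ : Ctx) (E : Ty) : sizeOf E ≤ sizeOf (arrs Θ E) := by
  induction Θ generalizing E with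
  | nil => exact le_rfl
  | cons B Θ ih => exact le_trans (by simp) (ih (.arr B E))

theorem sizeOf_lt_arrs {Θ : Ctx} {A : Ty} (h : A ∈ Θ) (E : Ty) : sizeOf A < sizeOf (arrs Θ E) := by
  induction Θ generalizing E with
  | nil => cases h
  | cons B Θ ih =>
    rcases List.mem_cons.1 h with rfl | h
    · exact lt_of_lt_of_le (by simp; omega) (sizeOf_le_arrs Θ (.arr A E))
    · exact ih h _

/-- Iterated application in the minimal model. -/
def Den.apps : (Θ : Ctx) → {E : Ty} → Den C (arrs Θ E) → Env C Θ → Den C E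
  | [], _, f, _ => f
  | _ :: Θ, _, f, e => (Den.apps Θ f e.tail).app (e _ .vz)

theorem Den.apps_ext (Θ : Ctx) {E : Ty} {f g : Den C (arrs Θ E)}
    (h : ∀ e, Den.apps Θ f e = Den.apps Θ g e) : f = g := by
  induction Θ generalizing E with
  | nil => exact h Env.nil
  | cons A Θ ih => exact ih fun e => Den.ext fun d => h (Env.cons d e)

/-- Iterated abstraction. -/
def Tm.lams {Δ : Ctx} : (Θ : Ctx) → {E : Ty} → Tm C (Θ ++ Δ) E → Tm C Δ (arrs Θ E)
  | [], _, t => t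
  | _ :: Θ, _, t => Tm.lams Θ (.lam t)

/-- Concatenation of environments. -/
def Env.append {Δ : Ctx} : (Θ : Ctx) → Env C Θ → Env C Δ → Env C (Θ ++ Δ)
  | [], _, δ => δ
  | _ :: Θ, e, δ => Env.cons (e _ .vz) (Env.append Θ e.tail δ)

/-- Inclusion of the variables of the first context. -/
def Var.inl {Δ : Ctx} : {Θ : Ctx} → {A : Ty} → Var Θ A → Var (Θ ++ Δ) A
  | _, _, .vz => .vz
  | _, _, .vs x => .vs x.inl

/-- Inclusion of the variables of the second context. -/
def Var.inr {Δ : Ctx} : (Θ : Ctx) → {A : Ty} → Var Δ A → Var (Θ ++ Δ) A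
  | [], _, x => x
  | _ :: Θ, _, x => .vs (x.inr Θ)

@[simp] theorem Env.append_inl {Θ Δ : Ctx} (e : Env C Θ) (δ : Env C Δ) {A : Ty} (x : Var Θ A) :
    Env.append Θ e δ A x.inl = e A x := by
  induction x with
  | vz => rfl
  | vs x ih => exact ih e.tail

@[simp] theorem Env.append_inr {Θ Δ : Ctx} (e : Env C Θ) (δ : Env C Δ) {A : Ty} (x : Var Δ A) :
    Env.append Θ e δ A (x.inr Θ) = δ A x := by
  induction Θ with
  | nil => rfl
  | cons B Θ ih => exact ih e.tail

theorem Var.inl_or_inr {Θ Δ : Ctx} {A : Ty} (v : Var (Θ ++ Δ) A) :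
    (∃ x : Var Θ A, v = x.inl) ∨ ∃ x : Var Δ A, v = x.inr Θ := by
  induction Θ with
  | nil => exact .inr ⟨v, rfl⟩
  | cons B Θ ih =>
    cases v with
    | vz => exact .inl ⟨.vz, rfl⟩
    | vs v =>
      rcases ih v with ⟨x, rfl⟩ | ⟨x, rfl⟩
      · exact .inl ⟨.vs x, rfl⟩
      · exact .inr ⟨x, rfl⟩

theorem Tm.apps_eval_lams {Δ : Ctx} (Θ : Ctx) {E : Ty} (t : Tm C (Θ ++ Δ) E) (δ : Env C Δ)
    (e : Env C Θ) : Den.apps Θ ((t.lams Θ).eval δ) e = t.eval (Env.append Θ e δ) := by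
  induction Θ generalizing E with
  | nil => rfl
  | cons A Θ ih =>
    exact (congrArg (fun f => Den.app f (e _ .vz)) (ih (.lam t) e.tail)).trans
      (Tm.eval_lam_app t _ _)

/-- Iterated application to variables. -/
def Tm.appVars {Γ : Ctx} : (Θ : Ctx) → {E : Ty} → Tm C Γ (arrs Θ E) → Ren Θ Γ → Tm C Γ E
  | [], _, t, _ => t
  | _ :: Θ, _, t, ι => .app (Tm.appVars Θ t fun _ x => ι _ (.vs x)) (.var (ι _ .vz))

theorem Tm.eval_appVars {Γ : Ctx} (Θ : Ctx) {E : Ty} (t : Tm C Γ (arrs Θ E)) (ι : Ren Θ Γ)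
    (ρ : Env C Γ) :
    (t.appVars Θ ι).eval ρ = Den.apps Θ (t.eval ρ) (fun _ x => ρ _ (ι _ x)) := by
  induction Θ generalizing E with
  | nil => rfl
  | cons A Θ ih => exact congrArg₂ Den.app (ih t _) (Tm.eval_var _ _)

theorem Tm.EtaLong.lams {Δ : Ctx} (Θ : Ctx) {E : Ty} {t : Tm C (Θ ++ Δ) E} (h : t.EtaLong) :
    (t.lams Θ).EtaLong := by
  induction Θ generalizing E with
  | nil => exact h
  | cons A Θ ih => exact ih ⟨h, .lam _⟩

theorem Tm.EtaLong.exists_lams {Δ : Ctx} (Θ : Ctx) {E : Ty} {t : Tm C Δ (arrs Θ E)}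
    (h : t.EtaLong) : ∃ b : Tm C (Θ ++ Δ) E, b.EtaLong ∧ t = b.lams Θ := by
  induction Θ generalizing E with
  | nil => exact ⟨t, h, rfl⟩
  | cons A Θ ih =>
    obtain ⟨b, ⟨hb, hs⟩, rfl⟩ := ih h
    cases hs with
    | lam b => exact ⟨b, hb, rfl⟩

theorem CellularIn.lams {Δ : Ctx} (Θ : Ctx) {E : Ty} {t : Tm C (Θ ++ Δ) E} (h : CellularIn t) :
    CellularIn (t.lams Θ) := by
  induction Θ generalizing E with
  | nil => exact h
  | cons A Θ ih => exact ih h.lam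

/-! ### Constant elements of the model -/

/-- The element `f` always returns the ground value `c`. -/
def Den.Returns (c : Den C .o) : {A : Ty} → Den C A → Prop
  | .o, f => f = c
  | .arr _ _, f => ∀ a, Den.Returns c (f.app a)

theorem Den.Returns.of_apps {c : Den C .o} (Θ : Ctx) {E : Ty} {f : Den C (arrs Θ E)}
    (h : ∀ e, Den.Returns c (Den.apps Θ f e)) : Den.Returns c f := by
  induction Θ generalizing E with
  | nil => exact h Env.nil
  | cons A Θ ih => exact ih fun e d => h (Env.cons d e)

/-- The head is a constant, necessarily unapplied, or a variable, whose value returns `c` whatever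
its arguments are. -/
theorem Tm.Normal.returns {Γ : Ctx} {B : Ty} {t : Tm C Γ B} (h : t.Normal) (hl : ¬ t.IsLam) :
    (∃ (hB : Ty.o = B) (a : C), t = hB ▸ .const a) ∨ ∀ (c : Den C .o) (ρ : Env C Γ),
      (∀ A x, Den.Returns c (ρ A x)) → Den.Returns c (t.eval ρ) := by
  induction t with
  | var x => exact .inr fun c ρ hρ => by simpa using hρ _ x
  | const a => exact .inl ⟨rfl, a, rfl⟩
  | app f a hf _ =>
    rcases hf h.1 h.2.1 with ⟨h, -⟩ | hr
    · simp at h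
    · exact .inr fun c ρ hρ => hr c ρ hρ (a.eval ρ)
  | lam b _ => exact absurd trivial hl

/-- A ground-valued element of the model is insensitive to the replacement of its argument by the
constant argument returning the result. -/
theorem Den.app_eq_of_returns {A : Ty} (g : Den C (.arr A .o)) {h k : Den C A}
    (hk : Den.Returns (g.app h) k) : g.app k = g.app h := by
  have key : ∀ d, g.app d = (Tm.app (g.rep.lift [A]) (.var .vz)).eval (Env.cons d Env.nil) :=
    fun d => by simp [Den.mk_rep, Env.cons]
  obtain ⟨v, hv, n⟩ := (Tm.app (g.rep.lift [A]) (.var .vz)).exists_normal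
  rcases n.returns v.not_isLam_of_ground with ⟨_, a, rfl⟩ | hr
  · rw [key, key, hv.eval_eq, hv.eval_eq]; rfl
  · rw [key k, hv.eval_eq]
    refine hr _ _ fun B x => ?_
    cases x with
    | vz => exact hk
    | vs x => cases x

variable {Γ : Ctx}

/-! ### Functions denoted by cellular terms -/

/-- The function `f` of the environment is denoted by a cellular term. -/
def IsCellular {A : Ty} (f : Env C Γ → Den C A) : Prop :=
  ∃ t : Tm C Γ A, CellularIn t ∧ ∀ ρ, t.eval ρ = f ρ

theorem IsCellular.cell {Δ : Ctx} {A : Ty} (hΔ : GroundCtx Δ) (y : Var Γ A) (s : Args C Δ A)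
    {r : Env C Γ → Env C Δ} (hr : ∀ B x, IsCellular fun ρ => r ρ B x) :
    IsCellular fun ρ => s.den (r ρ) (ρ A y) := by
  choose w hw he using hr
  refine ⟨_, CellularIn.cell ⟨hΔ, A, y, s⟩ w hw, fun ρ => ?_⟩
  simp [Cell.fill, Args.eval_apply, he]

/-- The values of an eta-long term whose free variables, of ground type, are replaced by functions
denoted by cellular terms. -/
def IsFilled {A : Ty} (f : Env C Γ → Den C A) : Prop :=
  ∃ Δ : Ctx, GroundCtx Δ ∧ ∃ (b : Tm C Δ A) (r : Env C Γ → Env C Δ), b.EtaLong ∧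
    (∀ B x, IsCellular fun ρ => r ρ B x) ∧ ∀ ρ, f ρ = b.eval (r ρ)

/-- A cell has a single list of holes for all its arguments, so the separate hole contexts are
concatenated. -/
theorem IsFilled.merge {Θ : Ctx} {η : Env C Γ → Env C Θ} (h : ∀ A x, IsFilled fun ρ => η ρ A x) :
    ∃ Δ : Ctx, GroundCtx Δ ∧ ∃ (b : Subst C Θ Δ) (r : Env C Γ → Env C Δ),
      (∀ A x, (b A x).EtaLong) ∧ (∀ B x, IsCellular fun ρ => r ρ B x) ∧
      ∀ ρ A x, η ρ A x = (b A x).eval (r ρ) := by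
  induction Θ with
  | nil =>
    exact ⟨[], fun _ h => (List.not_mem_nil h).elim, fun _ x => (by cases x), fun _ => Env.nil,
      fun _ x => (by cases x), fun _ x => (by cases x), fun _ _ x => (by cases x)⟩
  | cons A Θ ih =>
    obtain ⟨Δ₀, g₀, b₀, r₀, l₀, c₀, e₀⟩ := h A .vz
    obtain ⟨Δ, g, b, r, l, c, e⟩ := ih (η := fun ρ => (η ρ).tail) fun B x => h B (.vs x)
    refine ⟨Δ₀ ++ Δ, fun B hB => (List.mem_append.1 hB).elim (g₀ B) (g B),
      Subst.cons (b₀.rename fun _ x => x.inl) fun B x => (b B x).rename fun _ x => x.inr Δ₀,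
      fun ρ => Env.append Δ₀ (r₀ ρ) (r ρ), fun B x => ?_, fun B x => ?_, fun ρ B x => ?_⟩
    · cases x with
      | vz => exact l₀.rename _
      | vs x => exact (l B x).rename _
    · rcases x.inl_or_inr with ⟨x, rfl⟩ | ⟨x, rfl⟩
      · simpa using c₀ B x
      · simpa using c B x
    · cases x with
      | vz => simp [Subst.cons, Tm.eval_rename, e₀]
      | vs x => simpa [Subst.cons, Tm.eval_rename, Env.tail] using e ρ B x

/-- Composing `f` with a ground-valued function yields a function denoted by a cellular term as soon
as this holds for the functions of `IsFilled` in place of `f`. -/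
def IsReplaceable {A : Ty} (f : Env C Γ → Den C A) : Prop :=
  ∀ G : Env C Γ → Den C (.arr A .o), (∀ ψ, IsFilled ψ → IsCellular fun ρ => (G ρ).app (ψ ρ)) →
    IsCellular fun ρ => (G ρ).app (f ρ)

/-- Variables are replaced one at a time, the function `G` of `IsReplaceable` being the term
abstracted over the current variable. The term may depend on `ρ` so that values already chosen can
be substituted into it through representatives. -/
theorem IsReplaceable.eval {Θ : Ctx} (t : Env C Γ → Tm C Θ .o)
    (h : ∀ η : Env C Γ → Env C Θ, (∀ A x, IsFilled fun ρ => η ρ A x) →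
      IsCellular fun ρ => (t ρ).eval (η ρ))
    {η : Env C Γ → Env C Θ} (hη : ∀ A x, IsReplaceable fun ρ => η ρ A x) :
    IsCellular fun ρ => (t ρ).eval (η ρ) := by
  induction Θ with
  | nil => exact h η fun _ x => by cases x
  | cons A Θ ih =>
    have := hη A .vz (fun ρ => (Tm.lam (t ρ)).eval (η ρ).tail) fun ψ hψ => by
      have := ih (fun ρ => (t ρ).inst ((ψ ρ).rep.lift Θ)) (fun η' hη' => ?_) (η := fun ρ => (η ρ).tail)
        fun B x => hη B (.vs x)
      · simpa [Tm.eval_inst, Den.mk_rep] using this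
      · have := h (fun ρ => Env.cons (ψ ρ) (η' ρ)) fun B x => by
          cases x with
          | vz => exact hψ
          | vs x => exact hη' B x
        simpa [Tm.eval_inst, Den.mk_rep] using this
    simpa [Env.cons_tail] using this

/-- The arguments given by a substitution. -/
def Args.ofSubst {Δ : Ctx} : (Θ : Ctx) → (b : Subst C Θ Δ) → (∀ A x, (b A x).EtaLong) →
    {E : Ty} → Args C Δ E → Args C Δ (arrs Θ E)
  | [], _, _, _, s => s
  | _ :: Θ, b, hb, _, s =>
    Args.ofSubst Θ (fun _ x => b _ (.vs x)) (fun _ x => hb _ (.vs x)) (.cons (b _ .vz) (hb _ .vz) s)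

theorem Args.den_ofSubst {Δ : Ctx} (Θ : Ctx) (b : Subst C Θ Δ) (hb : ∀ A x, (b A x).EtaLong)
    {E : Ty} (s : Args C Δ E) (δ : Env C Δ) (f : Den C (arrs Θ E)) :
    (Args.ofSubst Θ b hb s).den δ f = s.den δ (Den.apps Θ f fun A x => (b A x).eval δ) := by
  induction Θ generalizing E with
  | nil => rfl
  | cons A Θ ih => exact ih _ _ _ _

theorem IsReplaceable.apps_var {Θ : Ctx} (y : Var Γ (arrs Θ .o)) {η : Env C Γ → Env C Θ}
    (hη : ∀ A x, IsReplaceable fun ρ => η ρ A x) :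
    IsCellular fun ρ => Den.apps Θ (ρ _ y) (η ρ) := by
  have := IsReplaceable.eval (fun ρ => ((ρ _ y).rep.lift Θ).appVars Θ fun _ x => x)
    (fun η hη => ?_) hη
  · simpa [Tm.eval_appVars, Den.mk_rep] using this
  · obtain ⟨Δ, g, b, r, l, c, e⟩ := IsFilled.merge hη
    have := IsCellular.cell g y (Args.ofSubst Θ b l .nil) c
    have he : ∀ ρ, η ρ = fun A x => (b A x).eval (r ρ) := fun ρ => by funext A x; exact e ρ A x
    simpa [Args.den_ofSubst, Args.den, Tm.eval_appVars, Den.mk_rep, he] using this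

/-- Applying `f` to arguments whose holes are filled with cellular terms yields a function denoted
by a cellular term. -/
def IsTestable {A : Ty} (f : Env C Γ → Den C A) : Prop :=
  ∀ (Δ : Ctx) (s : Args C Δ A) (r : Env C Γ → Env C Δ), GroundCtx Δ →
    (∀ B x, IsCellular fun ρ => r ρ B x) → IsCellular fun ρ => s.den (r ρ) (f ρ)

/-- The image of a variable under a map of types. -/
def Var.map (f : Ty → Ty) : {Δ : Ctx} → {A : Ty} → Var Δ A → Var (Δ.map f) (f A)
  | _, _, .vz => .vz
  | _, _, .vs x => .vs (x.map f)

/-- The environment given by elements of the types `f A`. -/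
def Env.map (f : Ty → Ty) : (Δ : Ctx) → (∀ A, Var Δ A → Den C (f A)) → Env C (Δ.map f)
  | [], _ => Env.nil
  | _ :: Δ, e => Env.cons (e _ .vz) (Env.map f Δ fun A x => e A (.vs x))

@[simp] theorem Env.map_map (f : Ty → Ty) {Δ : Ctx} (e : ∀ A, Var Δ A → Den C (f A)) {A : Ty}
    (x : Var Δ A) : Env.map f Δ e (f A) (x.map f) = e A x := by
  induction x with
  | vz => rfl
  | vs x ih => exact ih _

theorem Env.forall_map (f : Ty → Ty) {Δ : Ctx} {P : ∀ {A : Ty}, (Env C Γ → Den C A) → Prop}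
    {e : Env C Γ → ∀ A, Var Δ A → Den C (f A)} (h : ∀ A x, P fun ρ => e ρ A x) (A : Ty)
    (x : Var (Δ.map f) A) : P fun ρ => Env.map f Δ (e ρ) A x := by
  induction Δ with
  | nil => cases x
  | cons B Δ ih =>
    cases x with
    | vz => exact h B .vz
    | vs x => exact ih (e := fun ρ A x => e ρ A (.vs x)) (fun A x => h A (.vs x)) x

/-- The head is bound by `zs`, so the cell remains an eta-long term once its fillings are replaced
by filled functions. The term `t₀` makes those fillings, abstracted over `zs`, into variables so
that `IsReplaceable.eval` applies. -/
theorem IsReplaceable.of_cell_bound {Δ zs : Ctx} {B : Ty} {D : Env C Γ → Den C B}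
    (S : Cell C (zs ++ [B]) Δ) (w : Subst C Δ (zs ++ [B]))
    (hw : ∀ A x, IsReplaceable fun ρ => ((w A x).lams zs).eval (Env.cons (D ρ) Env.nil))
    (z : Var zs S.headTy) (hz : S.head = z.inl) :
    IsReplaceable fun ρ => ((S.fill w).lams zs).eval (Env.cons (D ρ) Env.nil) := by
  intro G hG
  let t₀ : Tm C (Δ.map fun A => arrs zs A) (arrs zs .o) := Tm.lams zs (S.args.apply
    (fun A k => (Tm.var ((k.map fun A => arrs zs A).inr zs)).appVars zs fun _ x => x.inl)
    (.var z.inl))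
  have ht₀ : ∀ ε e, Den.apps zs (t₀.eval ε) e =
      S.args.den (fun A k => Den.apps zs (ε _ (k.map fun A => arrs zs A)) e) (e _ z) := by
    intro ε e
    simp [t₀, Tm.apps_eval_lams, Args.eval_apply, Tm.eval_appVars]
  have := IsReplaceable.eval (fun ρ => Tm.app ((G ρ).rep.lift _) t₀) (fun η hη => ?_)
    (Env.forall_map (P := IsReplaceable) (fun A => arrs zs A) hw)
  · have he : ∀ ρ, t₀.eval (Env.map (fun A => arrs zs A) Δ fun A x =>
        ((w A x).lams zs).eval (Env.cons (D ρ) Env.nil)) =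
        ((S.fill w).lams zs).eval (Env.cons (D ρ) Env.nil) := fun ρ => by
      refine Den.apps_ext zs fun e => ?_
      rw [ht₀]
      simp [Tm.apps_eval_lams, Cell.fill, Args.eval_apply, hz]
    simpa [Den.mk_rep, he] using this
  · obtain ⟨Δ', g, b, r, l, c, e⟩ := IsFilled.merge hη
    choose b' lb' hb' using fun A (k : Var Δ A) => (l _ (k.map fun A => arrs zs A)).exists_lams zs
    have := hG (fun ρ => t₀.eval (η ρ)) ⟨Δ', g, Tm.lams zs (S.args.apply b' (.var z.inl)), r,
      Tm.EtaLong.lams zs ⟨S.args.apply_innerLong (fun A x => (lb' A x).1) trivial, .ground _⟩, c,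
      fun ρ => Den.apps_ext zs fun e' => by
        rw [ht₀]
        simp [Tm.apps_eval_lams, Args.eval_apply, e, hb']⟩
    simpa [Den.mk_rep] using this

/-- The head is `D`, which may not occur in a filled term. Applying `G` to each filling gives
cellular functions, and testability of `D` combines them into a cellular ground function `m`; the
substitute for the cell is the constant function `ψ` with value `m`. -/
theorem IsReplaceable.of_cell_head {Δ zs : Ctx} {B : Ty} {D : Env C Γ → Den C B}
    (hD : IsTestable D) (S : Cell C (zs ++ [B]) Δ) (w : Subst C Δ (zs ++ [B]))
    (hw : ∀ A x, IsReplaceable fun ρ => ((w A x).lams zs).eval (Env.cons (D ρ) Env.nil))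
    (z : Var [B] S.headTy) (hz : S.head = z.inr zs) :
    IsReplaceable fun ρ => ((S.fill w).lams zs).eval (Env.cons (D ρ) Env.nil) := by
  intro G hG
  obtain ⟨gr, H, hd, s⟩ := S
  dsimp only at z hz s
  cases z with
  | vs z => cases z
  | vz =>
  subst hz
  have hr : ∀ A (x : Var Δ A), ∃ r : Env C Γ → Den C A, IsCellular r ∧ ∀ h : A = .o, ∀ ρ,
      -- Hole types equal `o` only propositionally, hence the transports.
      (h ▸ r ρ : Den C .o) =
        (G ρ).app (((h ▸ w A x : Tm C _ .o).lams zs).eval (Env.cons (D ρ) Env.nil)) := by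
    intro A x
    obtain rfl := gr A x.mem
    exact ⟨_, hw _ x G hG, fun _ _ => rfl⟩
  choose r hrc hre using hr
  have hm : IsCellular fun ρ => s.den (fun A x => r A x ρ) (D ρ) := hD Δ s _ gr hrc
  set m : Env C Γ → Den C .o := fun ρ => s.den (fun A x => r A x ρ) (D ρ)
  set ψ : Env C Γ → Den C (arrs zs .o) := fun ρ =>
    (Tm.lams zs (.var (Var.inr zs (.vz : Var [Ty.o] Ty.o)))).eval (Env.cons (m ρ) Env.nil) with hψ
  have hψe : ∀ ρ e, Den.apps zs (ψ ρ) e = m ρ := fun ρ e => by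
    simp [hψ, Tm.apps_eval_lams, Env.cons]
  have hφe : ∀ ρ e, Den.apps zs (((Cell.fill ⟨gr, B, Var.inr zs .vz, s⟩ w).lams zs).eval
      (Env.cons (D ρ) Env.nil)) e =
      s.den (fun A x => (w A x).eval (Env.append zs e (Env.cons (D ρ) Env.nil))) (D ρ) :=
    fun ρ e => by simp [Tm.apps_eval_lams, Cell.fill, Args.eval_apply, Env.cons]
  have hc := hG ψ ⟨[.o], by simp [GroundCtx], Tm.lams zs (.var (Var.inr zs .vz)),
    fun ρ => Env.cons (m ρ) Env.nil,
    Tm.EtaLong.lams zs ⟨trivial, .ground _⟩, fun A x => (by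
      cases x with
      | vz => exact hm
      | vs x => cases x), fun ρ => rfl⟩
  convert hc using 2 with ρ
  -- The selected hole or constant may vary with `ρ`, but `ψ` was built without knowing it.
  rcases s.den_eq gr (D ρ) with ⟨x, hx⟩ | ⟨a, ha⟩
  · have h1 : ((Cell.fill ⟨gr, B, Var.inr zs .vz, s⟩ w).lams zs).eval (Env.cons (D ρ) Env.nil) =
        ((w _ x).lams zs).eval (Env.cons (D ρ) Env.nil) :=
      Den.apps_ext zs fun e => by rw [hφe, hx, Tm.apps_eval_lams]
    have h2 : m ρ = (G ρ).app (((w _ x).lams zs).eval (Env.cons (D ρ) Env.nil)) :=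
      (hx _).trans (hre _ x rfl ρ)
    refine (congrArg (G ρ).app h1).trans (Den.app_eq_of_returns _ (Den.Returns.of_apps zs fun e => ?_)).symm
    rw [← h2]
    exact hψe ρ e
  · congr 1
    exact Den.apps_ext zs fun e => by rw [hφe, hψe, ha]; exact (ha _).symm

/-- Induction on the cellular structure, `zs` collecting the abstractions crossed so far; a constant
is a filled term without holes. -/
theorem CellularIn.isReplaceable {B : Ty} {D : Env C Γ → Den C B} (hD : IsTestable D) {Ξ : Ctx}
    {E : Ty} {T : Tm C Ξ E} (hT : CellularIn T) (zs : Ctx) (h : Ξ = zs ++ [B]) :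
    IsReplaceable fun ρ => ((h ▸ T : Tm C (zs ++ [B]) E).lams zs).eval (Env.cons (D ρ) Env.nil) := by
  induction hT generalizing zs with
  | @lam _ A _ _ _ ih => subst h; exact ih (A :: zs) rfl
  | const a =>
    subst h
    exact fun G hG => hG _ ⟨[], by simp [GroundCtx], Tm.lams zs (.const a), fun _ => Env.nil,
      Tm.EtaLong.lams zs ⟨trivial, .ground _⟩, fun _ x => (by cases x),
      fun ρ => Den.apps_ext zs fun e => by simp [Tm.apps_eval_lams]⟩
  | cell S w _ ih =>
    subst h
    have hw := fun A x => ih A x zs rfl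
    rcases S.head.inl_or_inr with ⟨z, hz⟩ | ⟨z, hz⟩
    · exact .of_cell_bound S w hw z hz
    · exact .of_cell_head hD S w hw z hz

/-! ### Every open ground term is equivalent to a cellular one -/

/-- The identity of type `A → A` is denoted by a cellular term. -/
def HasCellularId (C : Type*) (A : Ty) : Prop :=
  ∃ t : Closed C (.arr A A), Cellular t ∧ ∀ d, (Den.mk t).app d = d

theorem HasCellularId.isReplaceable {B : Ty} (h : HasCellularId C B) {D : Env C Γ → Den C B}
    (hD : IsTestable D) : IsReplaceable D := by
  obtain ⟨t, ht, hid⟩ := h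
  cases ht with
  | @lam _ _ _ b hb =>
    have he : (fun ρ => b.eval (Env.cons (D ρ) Env.nil)) = D := funext fun ρ => by
      rw [← Tm.eval_lam_app, Tm.eval_closed, hid]
    have := hb.isReplaceable hD [] rfl
    exact he ▸ this

/-- The logical predicate which is `IsCellular` at ground type. -/
def IsExpressible : {A : Ty} → (Env C Γ → Den C A) → Prop
  | .o, f => IsCellular f
  | .arr _ _, f => ∀ a, IsExpressible a → IsExpressible fun ρ => (f ρ).app (a ρ)

theorem IsExpressible.eval {Ψ : Ctx} {A : Ty} (t : Tm C Ψ A) {κ : Env C Γ → Env C Ψ}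
    (hκ : ∀ A x, IsExpressible fun ρ => κ ρ A x) : IsExpressible fun ρ => t.eval (κ ρ) := by
  induction t with
  | var x => simpa using hκ _ x
  | const a => exact ⟨.const a, .const a, fun _ => rfl⟩
  | app f a hf ha => exact hf hκ _ (ha hκ)
  | lam b hb =>
    intro a ha
    simp only [Tm.eval_lam_app]
    refine hb (κ := fun ρ => Env.cons (a ρ) (κ ρ)) fun A x => ?_
    cases x with
    | vz => exact ha
    | vs x => exact hκ _ x

/-- At ground type expressible means cellular, so the holes are expressible, and hence so are the
arguments built from them. -/
theorem IsExpressible.isTestable {A : Ty} {f : Env C Γ → Den C A} (h : IsExpressible f) :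
    IsTestable f := by
  intro Δ s r hΔ hr
  induction s with
  | nil => exact h
  | cons c _ s ih =>
    refine ih (h _ (IsExpressible.eval c fun B x => ?_))
    obtain rfl := hΔ B x.mem
    exact hr _ x

theorem IsExpressible.of_apps (Θ : Ctx) {E : Ty} {f : Env C Γ → Den C (arrs Θ E)}
    (h : ∀ η : Env C Γ → Env C Θ, (∀ A x, IsExpressible fun ρ => η ρ A x) →
      IsExpressible fun ρ => Den.apps Θ (f ρ) (η ρ)) : IsExpressible f := by
  induction Θ generalizing E with
  | nil => exact h (fun _ => Env.nil) fun _ x => by cases x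
  | cons A Θ ih =>
    refine ih fun η hη a ha => h (fun ρ => Env.cons (a ρ) (η ρ)) fun B x => ?_
    cases x with
    | vz => exact ha
    | vs x => exact hη _ x

theorem isCellular_eval (hΓ : ∀ Θ : Ctx, arrs Θ .o ∈ Γ → ∀ B ∈ Θ, HasCellularId C B)
    (t : Tm C Γ .o) : IsCellular fun ρ => t.eval ρ := by
  refine IsExpressible.eval t fun A x => ?_
  obtain ⟨Θ, rfl⟩ := exists_arrs A
  refine IsExpressible.of_apps Θ fun η hη => IsReplaceable.apps_var x fun B y => ?_
  exact (hΓ Θ x.mem B y.mem).isReplaceable (hη B y).isTestable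

theorem hasCellularId (C : Type*) (A : Ty) : HasCellularId C A := by
  induction hn : sizeOf A using Nat.strong_induction_on generalizing A with
  | _ n ih =>
  subst hn
  obtain ⟨Θ, rfl⟩ := exists_arrs A
  -- The context contains the bound variables and the head variable of type `A`. Identities are
  -- needed at the argument types of all of them, each strictly smaller than `A`.
  obtain ⟨t, ht, he⟩ := isCellular_eval (C := C) (Γ := Θ ++ [arrs Θ .o]) (fun Θ' h B hB => by
      have hlt := sizeOf_lt_arrs hB .o
      rcases List.mem_append.1 h with h | h
      · exact ih _ (hlt.trans (sizeOf_lt_arrs h .o)) B rfl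
      · rw [List.mem_singleton] at h
        exact ih _ (h ▸ hlt) B rfl)
    ((Tm.var (Var.inr Θ .vz)).appVars Θ fun _ x => x.inl)
  refine ⟨.lam (t.lams Θ), ht.lams.lam, fun d => Den.apps_ext Θ fun e => ?_⟩
  rw [← Tm.eval_closed _ Env.nil, Tm.eval_lam_app, Tm.apps_eval_lams]
  refine ((he _).trans (Tm.eval_appVars _ _ _ _)).trans ?_
  simp [Env.cons]

end STLC

theorem mainTheorem3 {C : Type*} [Finite C] (A : STLC.Ty) :
    ∃ t : STLC.Closed C (STLC.Ty.arr A A),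
      STLC.Cellular t ∧ STLC.ObsEq t (STLC.etaId C A) ∧
      ∀ w : STLC.Closed C A, ∃ v : STLC.Closed C A,
        STLC.IsNormalFormOf v (STLC.Tm.app t w) ∧ STLC.Cellular v ∧ STLC.ObsEq v w := by
  open STLC in
  obtain ⟨t, ht, hid⟩ := hasCellularId C A
  refine ⟨t, ht, Den.mk_eq.1 (Den.ext fun d => ?_), fun w => ?_⟩
  · rw [hid, ← Tm.eval_closed (etaId C A) Env.nil, etaId, Tm.eval_lam_app, Tm.eval_etaExpand,
      Tm.eval_var]
    rfl
  · cases ht with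
    | @lam _ _ _ b hb =>
      obtain ⟨v, hv, n, hc⟩ := hb.exists_normal (Subst.single w) fun B x => by
        cases x with
        | vz => exact .inr ⟨w, w.lift_nil.symm⟩
        | vs x => cases x
      have hr : Reds (.app (.lam b) w) v := .head (.beta b w) hv
      refine ⟨v, ⟨hr, fun _ => n.not_step⟩, hc, Den.mk_eq.1 ?_⟩
      rw [← Tm.eval_closed v Env.nil, ← hr.eval_eq, Tm.eval_closed, Den.mk_app, hid]
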